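/- Consider a few-shot node classification problem on a finite labelled graph: a node distribution $P_{\mathcal V}$, a nonnegative loss that is Lipschitz in the embedding, a support and a query distribution with $W_1(P_{\mathcal S},P_{\mathcal Q})\le\delta$ where $\delta>0$, $T\ge 1$ training tasks and a calibration bandwidth $\sigma>0$. For a node $v$ let $d_v^{\mathrm{hom}}$ be the number of its neighbours with the same label and $d_v^{\mathrm{het}}$ its degree minus $d_v^{\mathrm{hom}}$. A two-expert (low-pass/high-pass) model with gating weights $\alpha_v\in[0,1]$ has gating error $\mathbb E_{v\sim P_{\mathcal V}}|\alpha_v-\mathbb I(d_v^{\mathrm{hom}}>d_v^{\mathrm{het}})|$; a single-filter model is one with $\alpha\equiv 1$ (low-pass only) or $\alpha\equiv 0$ (high-pass only). If $\epsilon_g$ and $\epsilon_g^{\mathrm{Sin}}$ are upper bounds of the gating errors of a mixture-of-experts model and of a single-filter model with the same calibration, their generalization bounds are $$\epsilon_{\mathrm{gen}}^{\mathrm{MoE}}=C_1\sqrt{\tfrac{\log T}{T}}+C_2\epsilon_g+C_3\bigl(\delta+b(\sigma)+r(|\mathcal Q|)\bigr),\qquad \epsilon_{\mathrm{gen}}^{\mathrm{Sin}}=C_1\sqrt{\tfrac{\log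 T}{T}}+C_2\epsilon_g^{\mathrm{Sin}}+C_3\bigl(\delta+b(\sigma)+r'(|\mathcal Q|)\bigr),$$ where $C_1,C_3\ge 0$ and $C_2>0$ are constants, $b(\sigma)=O(\sigma^2)$ as $\sigma\to0^+$, $r$ and $r'$ are $O(|\mathcal Q|^{-1/2})$ as $|\mathcal Q|\to\infty$, and $|\mathcal Q|$ is the number of query samples. Let $C_1,C_2,C_3,b,r,r'$ be given. There is a constant $K$ such that for every $\rho>0$ there is $q_0$ such that for all sufficiently small $\epsilon_g>0$ the following holds for every problem whose local topology is strongly heterogeneous at level $\rho$, that is $P_{\mathcal V}(d_v^{\mathrm{hom}}>d_v^{\mathrm{het}})\ge\rho$ and $P_{\mathcal V}(d_v^{\mathrm{hom}}\le d_v^{\mathrm{het}})\ge\rho$, every mixture-of-experts model with gating error at most $\epsilon_g$, every single-filter model and every upper bound $\epsilon_g^{\mathrm{Sin}}$ of its gating error: $$\epsilon_{\mathrm{gen}}^{\mathrm{MoE}}\le\epsilon_{\mathrm{gen}}^{\mathrm{Sin}}+K|\mathcal Q|^{-1/2}\quad\text{for all }|\mathcal Q|\ge1,\qquad\text{and}\qquad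 \epsilon_{\mathrm{gen}}^{\mathrm{MoE}}<\epsilon_{\mathrm{gen}}^{\mathrm{Sin}}\quad\text{for all }|\mathcal Q|\ge q_0 .$$ -/

import Mathlib

open MeasureTheory Filter Topology Asymptotics Set
open scoped ENNReal NNReal

noncomputable section

/-- The 1-Wasserstein distance: infimum of the transport cost over all couplings. -/
def wasserstein1 {E : Type*} [MeasurableSpace E] [PseudoEMetricSpace E] (μ ν : Measure E) : ℝ≥0∞ :=
  ⨅ (π : Measure (E × E)) (_ : π.map Prod.fst = μ) (_ : π.map Prod.snd = ν),
    ∫⁻ p, edist p.1 p.2 ∂π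

/-- A few-shot node classification problem on a finite labelled graph, with embeddings in
`ℝ^d`: the graph, the node labels, the node distribution, an `L`-Lipschitz nonnegative loss,
support and query distributions at Wasserstein distance at most `δ`, the number `T` of training
tasks, and the bandwidth `σ` of the calibration kernel. -/
structure FewShotProblem (V Y : Type*) [MeasurableSpace V] (d : ℕ) where
  graph : SimpleGraph V
  label : V → Y
  nodeDist : Measure V
  isProb_nodeDist : IsProbabilityMeasure nodeDist
  loss : EuclideanSpace ℝ (Fin d) → Y → ℝ
  loss_nonneg : ∀ z y, 0 ≤ loss z y
  L : ℝ≥0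
  loss_lipschitz : ∀ y, LipschitzWith L (fun z => loss z y)
  supportDist : Measure (EuclideanSpace ℝ (Fin d))
  isProb_supportDist : IsProbabilityMeasure supportDist
  queryDist : Measure (EuclideanSpace ℝ (Fin d))
  isProb_queryDist : IsProbabilityMeasure queryDist
  δ : ℝ
  δ_pos : 0 < δ
  shift_le : wasserstein1 supportDist queryDist ≤ ENNReal.ofReal δ
  T : ℕ
  T_pos : 1 ≤ T
  σ : ℝ
  σ_pos : 0 < σ

/-- The two spectrum experts. -/
inductive Expert
  | low
  | high

/-- The mixture-of-experts embedding: node `v` weighs the low-pass expert by `α v` and the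
high-pass expert by `1 - α v`. -/
def moeEmbedding {V : Type*} {d : ℕ} (α : V → ℝ) (Hlow Hhigh : V → EuclideanSpace ℝ (Fin d)) :
    V → EuclideanSpace ℝ (Fin d) :=
  fun v => α v • Hlow v + (1 - α v) • Hhigh v

/-- The gating weights of a model that applies one filter to all nodes. -/
def singleFilterGate {V : Type*} : Expert → V → ℝ
  | Expert.low => fun _ => 1
  | Expert.high => fun _ => 0

theorem moeEmbedding_singleFilterGate {V : Type*} {d : ℕ} (s : Expert)
    (Hlow Hhigh : V → EuclideanSpace ℝ (Fin d)) :
    moeEmbedding (singleFilterGate s) Hlow Hhigh =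
      match s with
      | Expert.low => Hlow
      | Expert.high => Hhigh := by
  cases s <;> funext v <;> simp [moeEmbedding, singleFilterGate]

namespace FewShotProblem

variable {V Y : Type*} [MeasurableSpace V] {d : ℕ}

/-- The homophily degree of `v`: the number of its neighbours with the same label. -/
def homDegree (P : FewShotProblem V Y d) (v : V) : ℕ :=
  {u | P.graph.Adj u v ∧ P.label u = P.label v}.ncard

/-- The heterophily degree of `v`: the degree of `v` minus its homophily degree. -/
def hetDegree (P : FewShotProblem V Y d) (v : V) : ℕ :=
  {u | P.graph.Adj u v}.ncard - P.homDegree v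

/-- The nodes whose local topology is homophilic. -/
def homNodes (P : FewShotProblem V Y d) : Set V :=
  {v | P.hetDegree v < P.homDegree v}

/-- The ideal gate: the indicator of `d_v^hom > d_v^het`. -/
def idealGate (P : FewShotProblem V Y d) : V → ℝ :=
  P.homNodes.indicator 1

/-- The gating error: the expectation over nodes of `|α v - 𝕀(d_v^hom > d_v^het)|`. -/
def gatingError (P : FewShotProblem V Y d) (α : V → ℝ) : ℝ :=
  ∫ v, |α v - P.idealGate v| ∂P.nodeDist

/-- Strong heterogeneity of the local topology at level `ρ`: homophilic nodes and the remaining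
nodes both have probability at least `ρ`. -/
def StronglyHeterogeneous (P : FewShotProblem V Y d) (ρ : ℝ) : Prop :=
  ρ ≤ P.nodeDist.real P.homNodes ∧ ρ ≤ P.nodeDist.real P.homNodesᶜ

/-- The generalization bound
`C₁ √(log T / T) + C₂ ε + C₃ (δ + bias σ + var q)` of a model with gating error at most `ε` and
`q` query samples; `bias` stands for the `O(σ²)` term and `var` for the `O(q^{-1/2})` term. -/
def genBound (P : FewShotProblem V Y d) (C₁ C₂ C₃ : ℝ) (bias : ℝ → ℝ) (var : ℕ → ℝ)
    (ε : ℝ) (q : ℕ) : ℝ :=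
  C₁ * √(Real.log P.T / P.T) + C₂ * ε + C₃ * (P.δ + bias P.σ + var q)

end FewShotProblem

end

namespace FewShotProblem

variable {V Y : Type*} [MeasurableSpace V] {d : ℕ}

/-! A constant gate errs by exactly 1 on the nodes that need the other filter and by 0 elsewhere, so
its gating error is the mass of those nodes, at least `ρ` (`StronglyHeterogeneous.le_gatingError`).
The `T`, `δ` and bias terms cancel between the two bounds. What remains is a gating gap of fixed
size against `C₃ * (varMoE q - varSin q)`, which is `O(q^{-1/2})` and eventually smaller than the
gap. -/

theorem abs_one_sub_idealGate (P : FewShotProblem V Y d) (v : V) :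
    |1 - P.idealGate v| = P.homNodesᶜ.indicator 1 v := by
  by_cases h : v ∈ P.homNodes <;> simp [idealGate, h]

theorem abs_zero_sub_idealGate (P : FewShotProblem V Y d) (v : V) :
    |0 - P.idealGate v| = P.homNodes.indicator 1 v := by
  by_cases h : v ∈ P.homNodes <;> simp [idealGate, h]

theorem gatingError_low (P : FewShotProblem V Y d) (h : MeasurableSet P.homNodes) :
    P.gatingError (singleFilterGate Expert.low) = P.nodeDist.real P.homNodesᶜ := by
  simp only [gatingError, singleFilterGate, abs_one_sub_idealGate]
  exact integral_indicator_one h.compl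

theorem gatingError_high (P : FewShotProblem V Y d) (h : MeasurableSet P.homNodes) :
    P.gatingError (singleFilterGate Expert.high) = P.nodeDist.real P.homNodes := by
  simp only [gatingError, singleFilterGate, abs_zero_sub_idealGate]
  exact integral_indicator_one h

/-- On a strongly heterogeneous graph a single filter misroutes at least a fraction `ρ` of the
nodes. -/
theorem StronglyHeterogeneous.le_gatingError {P : FewShotProblem V Y d} {ρ : ℝ}
    (hP : P.StronglyHeterogeneous ρ) (h : MeasurableSet P.homNodes) (s : Expert) :
    ρ ≤ P.gatingError (singleFilterGate s) := by
  cases s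
  · exact (P.gatingError_low h).symm ▸ hP.2
  · exact (P.gatingError_high h).symm ▸ hP.1

end FewShotProblem

/-- An `O(q^{-1/2})` sequence is bounded by a multiple of `q^{-1/2}` at every `q ≥ 1`. -/
theorem exists_abs_le_mul_rpow_of_isBigO {f : ℕ → ℝ}
    (hf : f =O[atTop] fun q : ℕ => (q : ℝ) ^ (-(1 / 2) : ℝ)) :
    ∃ C : ℝ, ∀ q : ℕ, 1 ≤ q → |f q| ≤ C * (q : ℝ) ^ (-(1 / 2) : ℝ) := by
  -- The constant absorbs the finitely many initial terms. Only `q = 0` is lost, where the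
  -- comparison function is `0`.
  obtain ⟨C, -, hC⟩ := bound_of_isBigO_nat_atTop hf
  refine ⟨C, fun q hq => ?_⟩
  have hpos : 0 < (q : ℝ) ^ (-(1 / 2) : ℝ) := Real.rpow_pos_of_pos (by exact_mod_cast hq) _
  simpa only [Real.norm_eq_abs, abs_of_pos hpos] using hC hpos.ne'

theorem tendsto_natCast_rpow_neg_half :
    Tendsto (fun q : ℕ => (q : ℝ) ^ (-(1 / 2) : ℝ)) atTop (𝓝 0) :=
  (tendsto_rpow_neg_atTop (by norm_num : (0 : ℝ) < 1 / 2)).comp tendsto_natCast_atTop_atTop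

theorem corollary1
    (C₁ C₂ C₃ : ℝ) (hC₁ : 0 ≤ C₁) (hC₂ : 0 < C₂) (hC₃ : 0 ≤ C₃)
    (bias : ℝ → ℝ) (hbias : bias =O[𝓝[>] 0] fun s : ℝ => s ^ 2)
    (varMoE varSin : ℕ → ℝ)
    (hMoE : varMoE =O[atTop] fun q : ℕ => (q : ℝ) ^ (-(1 / 2) : ℝ))
    (hSin : varSin =O[atTop] fun q : ℕ => (q : ℝ) ^ (-(1 / 2) : ℝ)) :
    ∃ K : ℝ, ∀ ρ : ℝ, 0 < ρ → ∃ q₀ : ℕ, ∀ᶠ εg : ℝ in 𝓝[>] 0,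
      ∀ (V Y : Type*) [Fintype V] [MeasurableSpace V] [MeasurableSingletonClass V] (d : ℕ)
        (P : FewShotProblem V Y d), P.StronglyHeterogeneous ρ →
      ∀ α : V → ℝ, (∀ v, α v ∈ Icc (0 : ℝ) 1) → P.gatingError α ≤ εg →
      ∀ (s : Expert) (εSin : ℝ), P.gatingError (singleFilterGate s) ≤ εSin →
        (∀ q : ℕ, 1 ≤ q →
          P.genBound C₁ C₂ C₃ bias varMoE εg q ≤
            P.genBound C₁ C₂ C₃ bias varSin εSin q + K * (q : ℝ) ^ (-(1 / 2) : ℝ)) ∧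
        (∀ q : ℕ, q₀ ≤ q →
          P.genBound C₁ C₂ C₃ bias varMoE εg q < P.genBound C₁ C₂ C₃ bias varSin εSin q) := by
  -- Neither `ρ` nor the problem enters this difference, so `K` is uniform in both.
  have hdiff := (hMoE.sub hSin).const_mul_left C₃
  obtain ⟨K, hK⟩ := exists_abs_le_mul_rpow_of_isBigO hdiff
  refine ⟨K, fun ρ hρ => ?_⟩
  -- Half of `ρ` is given up to `εg`; the other half must beat the sampling terms. Hence `q₀` does
  -- not depend on `εg`.
  have hsmall : ∀ᶠ q : ℕ in atTop, C₃ * (varMoE q - varSin q) < C₂ * (ρ / 2) :=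
    (hdiff.trans_tendsto tendsto_natCast_rpow_neg_half).eventually_lt_const (by positivity)
  obtain ⟨q₀, hq₀⟩ := eventually_atTop.1 hsmall
  refine ⟨q₀, ?_⟩
  filter_upwards [Ioo_mem_nhdsGT (half_pos hρ)] with εg hεg
  intro V Y _ _ _ d P hP α _ _ s εSin hεSin
  have hgap : C₂ * (ρ / 2) ≤ C₂ * (εSin - εg) := by
    have := hP.le_gatingError (Set.toFinite _).measurableSet s
    exact mul_le_mul_of_nonneg_left (by linarith [hεg.2]) hC₂.le
  have hgap_pos : 0 < C₂ * (ρ / 2) := by positivity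
  refine ⟨fun q hq => ?_, fun q hq => ?_⟩
  -- Here only the sign of the gap matters; below, its size does.
  · have := (le_abs_self _).trans (hK q hq)
    simp only [FewShotProblem.genBound]
    linarith
  · have := hq₀ q hq
    simp only [FewShotProblem.genBound]
    linarith
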